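/- Let $D$ be a locally compact Hausdorff space with a countable base, let $X(t)$ be a Hunt process on $D$ with cemetery point $\partial$, laws $\mathbb{P}^x$ and lifetime $\zeta\in(0,\infty]$, and let $m$ be a finite Borel measure on $D$ such that $X(t)$ is self-dual with respect to $m$, that is, the transition operators $P_t f(x)=\mathbb{E}^x f(X(t))$ (with $f(\partial)=0$) are self-adjoint on $L^2(m)$. The Fleming–Viot system of two particles driven by $X(t)$ and started at $(x,y)\in D\times D$, with law $\bar{\mathbb{P}}^{x,y}$, is constructed as follows. Set $\tau_0=0$ and let $(X_1,Y_1)$ be independent copies of $X$ started at $x$ and $y$, respectively. For $n\ge 1$, put $\sigma_n=\min\{\zeta^{X_n},\zeta^{Y_n}\}$ and $\tau_n=\tau_{n-1}+\sigma_n$, and let $Z_n$ be the position of the surviving particle at the death of the other one: $Z_n=X_n(\zeta^{Y_n})$ if $\zeta^{Y_n}<\zeta^{X_n}$, $Z_n=Y_n(\zeta^{X_n})$ if $\zeta^{X_n}<\zeta^{Y_n}$, and $Z_n=\partial$ if $\zeta^{X_n}=\zeta^{Y_n}$. Given the past, $(X_{n+1},Y_{n+1})$ is a pair of independent copies of $X$,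 both started at $Z_n$ (at $\partial$ the lifetime is $0$). The system follows $(X_n,Y_n)$ on the time interval $[\tau_{n-1},\tau_n)$. Let $\tau_\infty=\lim_{n\to\infty}\tau_n\in(0,\infty]$; extinction (branching explosion) is the event $\{\tau_\infty<\infty\}$. For a probability measure $\mu$ on $D\times D$, $\bar{\mathbb{P}}^{\mu}$ denotes the law of the system whose initial configuration has distribution $\mu$. Then extinction almost surely never happens, for almost every initial configuration: (a) $\bar{\mathbb{P}}^{x,y}(\tau_\infty=\infty)=1$ for $m\times m$-almost every $(x,y)\in D\times D$; moreover, $\bar{\mathbb{P}}^{\mu}(\tau_\infty=\infty)=1$ for every probability measure $\mu$ on $D\times D$ that is absolutely continuous with respect to $m\times m$; (b) $\bar{\mathbb{P}}^{x,x}(\tau_\infty=\infty)=1$ for $m$-almost every $x\in D$. -/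

import Mathlib

open MeasureTheory ProbabilityTheory Filter Topology
open scoped NNReal ENNReal

/-! ## The state space with a cemetery point

For a locally compact Hausdorff space `D` with a countable base, `OnePoint D` is the one-point
compactification of `D` (with the added point isolated if `D` is compact); the added point
`OnePoint.infty` is the cemetery point `∂`. -/

instance OnePoint.instMeasurableSpaceBorel (D : Type*) [TopologicalSpace D] :
    MeasurableSpace (OnePoint D) := borel (OnePoint D)

instance OnePoint.instBorelSpaceBorel (D : Type*) [TopologicalSpace D] :
    BorelSpace (OnePoint D) := ⟨rfl⟩

theorem OnePoint.secondCountable_of_locallyCompact (D : Type*) [TopologicalSpace D]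
    [LocallyCompactSpace D] [T2Space D] [SecondCountableTopology D] :
    SecondCountableTopology (OnePoint D) := by
  let K : CompactExhaustion D := default
  let B : Set (Set (OnePoint D)) :=
    (fun U : Set D => ((↑) '' U : Set (OnePoint D))) '' TopologicalSpace.countableBasis D ∪
      Set.range (fun n : ℕ => ((↑) '' (K n) : Set (OnePoint D))ᶜ)
  have hB : TopologicalSpace.IsTopologicalBasis B := by
    refine TopologicalSpace.isTopologicalBasis_of_isOpen_of_nhds ?_ ?_
    · rintro u (⟨U, hU, rfl⟩ | ⟨n, rfl⟩)
      · exact OnePoint.isOpen_image_coe.2 (TopologicalSpace.isOpen_of_mem_countableBasis hU)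
      · exact OnePoint.isOpen_compl_image_coe.2 ⟨(K.isCompact n).isClosed, K.isCompact n⟩
    · intro a u ha hu
      induction a using OnePoint.rec with
      | infty =>
        have hc := ((OnePoint.isOpen_iff_of_mem' ha).1 hu).1
        obtain ⟨n, hn⟩ := K.exists_superset_of_isCompact hc
        refine ⟨_, Or.inr ⟨n, rfl⟩, OnePoint.infty_notMem_image_coe, ?_⟩
        intro z hz
        induction z using OnePoint.rec with
        | infty => exact ha
        | coe z =>
          by_contra h
          exact hz ⟨z, hn h, rfl⟩
      | coe a =>
        have hu' : IsOpen ((↑) ⁻¹' u : Set D) := hu.preimage OnePoint.continuous_coe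
        obtain ⟨v, hv, hav, hvu⟩ :=
          (TopologicalSpace.isBasis_countableBasis D).exists_subset_of_mem_open
            (show a ∈ ((↑) ⁻¹' u : Set D) from ha) hu'
        exact ⟨_, Or.inl ⟨v, hv, rfl⟩, ⟨a, hav, rfl⟩, Set.image_subset_iff.2 hvu⟩
  exact hB.secondCountableTopology
    (((TopologicalSpace.countable_countableBasis D).image _).union (Set.countable_range _))

noncomputable section

/-! ## Hunt processes -/

/-- The natural filtration of a process. -/
def naturalFiltration {E Ω : Type*} [MeasurableSpace E] [mΩ : MeasurableSpace Ω]
    (X : ℝ≥0 → Ω → E) (hX : ∀ t, Measurable (X t)) : Filtration ℝ≥0 mΩ where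
  seq t := ⨆ s : Set.Iic t, MeasurableSpace.comap (X s) inferInstance
  mono' _ _ hst := iSup_le fun r =>
    le_iSup (fun s : Set.Iic _ => MeasurableSpace.comap (X s) inferInstance)
      ⟨r.1, r.2.trans hst⟩
  le' _ := iSup_le fun s => (hX s).comap_le

/-- The value of a process with cemetery point `∂` at a possibly infinite time, with the
convention that the process sits at the cemetery point at time `⊤`. -/
def valueAt {D Ω : Type*} (X : ℝ≥0 → Ω → OnePoint D) (T : ℝ≥0∞) (ω : Ω) : OnePoint D :=
  if T = ⊤ then OnePoint.infty else X T.toNNReal ω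

/-- A Hunt process on `D`, realised on `Ω`: a normal Markov family `P x`, `x ∈ D ∪ {∂}`, of laws of
a process `X` whose paths are right-continuous with left limits in the one-point compactification
of `D` and are absorbed at `∂`, which has the strong Markov property and is quasi-left-continuous.
Stopping times are those of the right-continuous natural filtration `𝓕₊` (optional times);
the σ-algebra of `Ω` is one for which `x ↦ P x A` is a Borel function for each event `A`
(such as the σ-algebra generated by `X`). -/
structure HuntProcess (D Ω : Type*) [TopologicalSpace D] [MeasurableSpace Ω] where
  /-- the process -/
  X : ℝ≥0 → Ω → OnePoint D
  /-- the law of the process started at a given point -/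
  P : Kernel (OnePoint D) Ω
  isMarkovKernel_P : IsMarkovKernel P
  measurable_X : ∀ t, Measurable (X t)
  /-- under `P x`, the process starts at `x` -/
  normal : ∀ x, ∀ᵐ ω ∂(P x), X 0 ω = x
  absorbed : ∀ ω s t, s ≤ t → X s ω = OnePoint.infty → X t ω = OnePoint.infty
  right_continuous : ∀ ω t, ContinuousWithinAt (fun s => X s ω) (Set.Ioi t) t
  left_limits : ∀ ω t, 0 < t → ∃ l, Tendsto (fun s => X s ω) (𝓝[<] t) (𝓝 l)
  /-- `P x (X (T + t) ∈ B | 𝓕₊ T) = P (X T) (X t ∈ B)` almost surely on `{T < ⊤}` -/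
  strong_markov : ∀ (T : Ω → ℝ≥0∞)
    (hT : IsStoppingTime (naturalFiltration X measurable_X).rightCont T)
    (A : Set Ω), MeasurableSet[hT.measurableSpace] A →
    ∀ (x : OnePoint D) (t : ℝ≥0) (B : Set (OnePoint D)), MeasurableSet B →
      P x (A ∩ {ω | T ω < ⊤} ∩ {ω | valueAt X (T ω + t) ω ∈ B}) =
        ∫⁻ ω in A ∩ {ω | T ω < ⊤}, P (valueAt X (T ω) ω) {ω' | X t ω' ∈ B} ∂(P x)
  quasi_left_continuous : ∀ T : ℕ → Ω → ℝ≥0∞,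
    (∀ n, IsStoppingTime (naturalFiltration X measurable_X).rightCont (T n)) →
    (∀ ω, Monotone fun n => T n ω) →
    ∀ x, ∀ᵐ ω ∂(P x), (⨆ n, T n ω) < ⊤ →
      Tendsto (fun n => valueAt X (T n ω) ω) atTop (𝓝 (valueAt X (⨆ n, T n ω) ω))

namespace HuntProcess

attribute [instance] HuntProcess.isMarkovKernel_P

variable {D Ω : Type*} [TopologicalSpace D] [MeasurableSpace Ω]

/-- The transition operator `P_t f (x) = E^x f(X(t))`, where `f` is extended by `f(∂) = 0`. -/
def transOp (H : HuntProcess D Ω) (t : ℝ≥0) (f : D → ℝ) (x : D) : ℝ :=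
  ∫ ω, (H.X t ω).elim 0 f ∂(H.P x)

/-- Self-duality (symmetry) with respect to `m`: the transition operators are self-adjoint
on `L²(m)`. -/
def IsSelfDual [MeasurableSpace D] (H : HuntProcess D Ω) (m : Measure D) : Prop :=
  ∀ (t : ℝ≥0) (f g : D → ℝ), Measurable f → Measurable g → MemLp f 2 m → MemLp g 2 m →
    ∫ x, H.transOp t f x * g x ∂m = ∫ x, f x * H.transOp t g x ∂m

/-- The lifetime `ζ` of a path. -/
def lifetime (H : HuntProcess D Ω) (ω : Ω) : ℝ≥0∞ :=
  ⨅ (t : ℝ≥0) (_ : H.X t ω = OnePoint.infty), (t : ℝ≥0∞)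

/-- The time `σ = min {ζ^X, ζ^Y}` at which the first of the two particles dies. -/
def firstDeath (H : HuntProcess D Ω) (p : Ω × Ω) : ℝ≥0∞ :=
  min (H.lifetime p.1) (H.lifetime p.2)

/-- The position `Z` of the surviving particle when the other one dies (`∂` if both lifetimes
are equal). -/
def survivor (H : HuntProcess D Ω) (p : Ω × Ω) : OnePoint D :=
  if H.lifetime p.2 < H.lifetime p.1 then valueAt H.X (H.lifetime p.2) p.1
  else if H.lifetime p.1 < H.lifetime p.2 then valueAt H.X (H.lifetime p.1) p.2
  else OnePoint.infty

theorem measurable_lifetime [T1Space (OnePoint D)] (H : HuntProcess D Ω) :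
    Measurable H.lifetime := by
  refine measurable_of_Iio fun a => ?_
  have : H.lifetime ⁻¹' Set.Iio a =
      ⋃ (q : ℚ) (_ : ((Real.toNNReal q : ℝ≥0) : ℝ≥0∞) < a),
        {ω | H.X (Real.toNNReal q) ω = OnePoint.infty} := by
    ext ω
    simp only [lifetime, Set.mem_preimage, Set.mem_Iio, iInf_lt_iff, Set.mem_iUnion,
      Set.mem_ofPred_eq, exists_prop]
    constructor
    · rintro ⟨t, ht, hta⟩
      obtain ⟨q, -, htq, hqa⟩ := ENNReal.lt_iff_exists_rat_btwn.1 hta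
      exact ⟨q, hqa, H.absorbed ω t _ (by exact_mod_cast htq.le) ht⟩
    · rintro ⟨q, hqa, hq⟩
      exact ⟨_, hq, hqa⟩
  rw [this]
  exact MeasurableSet.iUnion fun q => MeasurableSet.iUnion fun _ =>
    H.measurable_X _ (measurableSet_singleton _)

/-! ## Branching times of the Fleming–Viot system of two particles

A trajectory of the system is a sequence `w` of pairs of paths: `w n` is the pair of paths that the
two particles follow between the `n`-th and the `(n+1)`-st branching time. -/

/-- The branching times `τ_0 = 0`, `τ_{n+1} = τ_n + σ_{n+1}`. -/
def branchingTime (H : HuntProcess D Ω) (n : ℕ) (w : ℕ → Ω × Ω) : ℝ≥0∞ :=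
  ∑ i ∈ Finset.range n, H.firstDeath (w i)

/-- The time `τ_∞ = lim τ_n`. -/
def explosionTime (H : HuntProcess D Ω) (w : ℕ → Ω × Ω) : ℝ≥0∞ :=
  ⨆ n, H.branchingTime n w

open Classical in
/-- The positions of the two particles at time `t`: between two branching times they follow the
corresponding pair of paths, and they are put at `∂` from time `τ_∞` on. -/
def particles (H : HuntProcess D Ω) (w : ℕ → Ω × Ω) (t : ℝ≥0) : OnePoint D × OnePoint D :=
  if h : ∃ n, (t : ℝ≥0∞) < H.branchingTime (n + 1) w then
    (H.X (t - (H.branchingTime (Nat.find h) w).toNNReal) (w (Nat.find h)).1,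
      H.X (t - (H.branchingTime (Nat.find h) w).toNNReal) (w (Nat.find h)).2)
  else (OnePoint.infty, OnePoint.infty)

/-- Extinction (branching explosion): `τ_∞ < ∞`. -/
def Extinct (H : HuntProcess D Ω) (w : ℕ → Ω × Ω) : Prop :=
  H.explosionTime w < ⊤

variable [LocallyCompactSpace D] [T2Space D] [SecondCountableTopology D]

theorem measurable_uncurry_X (H : HuntProcess D Ω) :
    Measurable fun q : ℝ≥0 × Ω => H.X q.1 q.2 := by
  have := OnePoint.secondCountable_of_locallyCompact D
  let u : ℕ → ℝ≥0 → ℝ≥0 := fun n t => ((⌊t * (n + 1)⌋₊ : ℝ≥0) + 1) / (n + 1)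
  have hu_gt : ∀ n t, t < u n t := fun n t => by
    have h : t * ((n : ℝ≥0) + 1) < (⌊t * (n + 1)⌋₊ : ℝ≥0) + 1 := Nat.lt_floor_add_one _
    exact (lt_div_iff₀ (by positivity)).2 h
  have hu_le : ∀ n t, u n t ≤ t + 1 / (n + 1) := fun n t => by
    have h : (⌊t * ((n : ℝ≥0) + 1)⌋₊ : ℝ≥0) ≤ t * (n + 1) := Nat.floor_le (by positivity)
    calc u n t ≤ (t * (n + 1) + 1) / (n + 1) := by simp only [u]; gcongr
      _ = t + 1 / (n + 1) := by field_simp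
  refine measurable_of_tendsto_metrizable (f := fun n q => H.X (u n q.1) q.2) (fun n => ?_) ?_
  · have h1 : Measurable fun r : ℕ × Ω => H.X (((r.1 : ℝ≥0) + 1) / (n + 1)) r.2 :=
      measurable_from_prod_countable_right fun k => H.measurable_X (((k : ℝ≥0) + 1) / (n + 1))
    have h2 : Measurable fun q : ℝ≥0 × Ω => (⌊q.1 * ((n : ℝ≥0) + 1)⌋₊, q.2) :=
      (Nat.measurable_floor.comp (measurable_fst.mul_const ((n : ℝ≥0) + 1))).prodMk measurable_snd
    have h3 := h1.comp h2
    simp only [Function.comp_def] at h3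
    exact h3
  · refine tendsto_pi_nhds.2 fun q => ?_
    refine (H.right_continuous q.2 q.1).tendsto.comp (tendsto_nhdsWithin_iff.2
      ⟨?_, Eventually.of_forall fun n => hu_gt n q.1⟩)
    refine tendsto_of_tendsto_of_tendsto_of_le_of_le tendsto_const_nhds ?_
      (fun n => (hu_gt n q.1).le) (fun n => hu_le n q.1)
    simpa using (tendsto_const_nhds (x := q.1)).add
      (tendsto_one_div_add_atTop_nhds_zero_nat (𝕜 := ℝ≥0))

theorem measurable_survivor (H : HuntProcess D Ω) : Measurable H.survivor := by
  have hv : Measurable fun q : ℝ≥0∞ × Ω => valueAt H.X q.1 q.2 :=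
    Measurable.ite (measurable_fst (measurableSet_singleton ⊤)) measurable_const
      (H.measurable_uncurry_X.comp
        ((ENNReal.measurable_toNNReal.comp measurable_fst).prodMk measurable_snd))
  have h1 : Measurable fun p : Ω × Ω => H.lifetime p.1 := H.measurable_lifetime.comp measurable_fst
  have h2 : Measurable fun p : Ω × Ω => H.lifetime p.2 := H.measurable_lifetime.comp measurable_snd
  exact Measurable.ite (measurableSet_lt h2 h1) (hv.comp (h2.prodMk measurable_fst))
    (Measurable.ite (measurableSet_lt h1 h2) (hv.comp (h1.prodMk measurable_snd))
      measurable_const)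

/-! ## The law of the Fleming–Viot system of two particles -/

/-- The conditional law of the next pair of paths, given the pairs up to index `n`: two independent
copies of the process, both started at the position of the last survivor. -/
def branchKernel (H : HuntProcess D Ω) (n : ℕ) : Kernel (Π _ : Finset.Iic n, Ω × Ω) (Ω × Ω) :=
  (Kernel.parallelComp H.P H.P).comap
    (fun w => (H.survivor (w ⟨n, Finset.mem_Iic.2 le_rfl⟩),
      H.survivor (w ⟨n, Finset.mem_Iic.2 le_rfl⟩)))
    ((H.measurable_survivor.comp (measurable_pi_apply _)).prodMk
      (H.measurable_survivor.comp (measurable_pi_apply _)))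

instance (H : HuntProcess D Ω) (n : ℕ) : IsMarkovKernel (H.branchKernel n) := by
  unfold branchKernel; infer_instance

/-- The law of the Fleming–Viot system of two particles whose initial configuration has
distribution `μ` on `D × D`: given the initial configuration `(x, y)`, the first pair of paths has
law `P^x ⊗ P^y`, and every subsequent pair is sampled according to `branchKernel`. -/
def flemingViot [MeasurableSpace D] (H : HuntProcess D Ω) (μ : Measure (D × D)) :
    Measure (ℕ → Ω × Ω) :=
  Kernel.trajMeasure (X := fun _ => Ω × Ω)
    ((μ.map fun z => ((z.1 : OnePoint D), (z.2 : OnePoint D))).bind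
      (Kernel.parallelComp H.P H.P))
    H.branchKernel

end HuntProcess
end

/-! The measure `m` is subinvariant for the chain of survivor positions, with constant exactly 1.
Write `a t x` for the probability that the process from `x` is alive at time `t`. Self-duality
tested on an indicator and `a t` gives ∫ P_s 1_B · a t dm = ∫_B a (s + t) dm. For two independent
copies started from a common `m`-distributed point, this expresses the law of one position, jointly
with the death of the other copy in a grid cell, through increments of `a` over `B`. Summed over
cells, these increments telescope, with no factor lost (`IsSelfDual.sum_diagLaw_visits_prod_diesIn`,
`IsSelfDual.diagLaw_survivor_le`).

Hence, if the first survivor has law at most `C * m`, so do all later ones, and every later pair of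
paths has law at most `C • diagLaw m`, with the same `C`. Extinction forces the gaps between
branchings to tend to 0, while `diagLaw m` gives small mass to short gaps. So extinction has
probability at most `C` times an arbitrarily small number (`IsSelfDual.ae_not_extinct`).

Simultaneous deaths must also be excluded. On the diagonal, their grid probabilities are second
differences of the survival function, whose diagonal sum is at most its first decrement; for the
product law, convexity gives a similar bound. Both bounds vanish with the mesh. -/

/-! ### Limits of sets and the time grid. -/

/-- Fatou for sets. Continuity along increasing unions holds for arbitrary sets, so no measurability
is needed. -/
theorem measure_le_liminf_of_eventually_mem {α : Type*} [MeasurableSpace α] {μ : Measure α}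
    {E : Set α} {F : ℕ → Set α} {c : ℕ → ℝ≥0∞} (hE : ∀ x ∈ E, ∀ᶠ n in atTop, x ∈ F n)
    (hF : ∀ n, μ (F n) ≤ c n) : μ E ≤ liminf c atTop := by
  have hsub : E ⊆ ⋃ N : ℕ, ⋂ n ≥ N, F n := fun x hx => by
    obtain ⟨N, hN⟩ := eventually_atTop.1 (hE x hx)
    exact Set.mem_iUnion.2 ⟨N, Set.mem_iInter₂.2 hN⟩
  have hmono : Monotone fun N : ℕ => ⋂ n ≥ N, F n := fun N M h =>
    Set.iInter₂_mono' fun n hn => ⟨n, h.trans hn, subset_rfl⟩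
  refine (measure_mono hsub).trans ?_
  rw [hmono.measure_iUnion, liminf_eq_iSup_iInf_of_nat]
  exact iSup_mono fun N => le_iInf₂ fun n hn =>
    (measure_mono (Set.iInter₂_subset n hn)).trans (hF n)

theorem measure_eq_zero_of_eventually_mem {α : Type*} [MeasurableSpace α] {μ : Measure α}
    {E : Set α} {F : ℕ → Set α} {c : ℕ → ℝ≥0∞} (hE : ∀ x ∈ E, ∀ᶠ n in atTop, x ∈ F n)
    (hF : ∀ n, μ (F n) ≤ c n) (hc : Tendsto c atTop (𝓝 0)) : μ E = 0 :=
  le_antisymm ((measure_le_liminf_of_eventually_mem hE hF).trans hc.liminf_eq.le) zero_le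

theorem NNReal.exists_grid_interval {T δ : ℝ≥0} (hT : 0 < T) (hδ : 0 < δ) :
    ∃ k : ℕ, k * δ < T ∧ T ≤ (k + 1) * δ := by
  have hex : ∃ n : ℕ, T ≤ n * δ := by
    obtain ⟨n, hn⟩ := exists_nat_ge (T / δ)
    exact ⟨n, (div_le_iff₀ hδ).1 hn⟩
  classical
  have hne : Nat.find hex ≠ 0 := fun h => by
    have := Nat.find_spec hex
    rw [h] at this
    simp only [Nat.cast_zero, zero_mul] at this
    exact absurd hT this.not_gt
  obtain ⟨k, hk⟩ := Nat.exists_eq_succ_of_ne_zero hne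
  refine ⟨k, not_le.1 (Nat.find_min hex (by omega)), ?_⟩
  have := Nat.find_spec hex
  rw [hk] at this
  simpa using this

namespace HuntProcess

/-! ### Pathwise facts: lifetimes, grid cells, position at the other particle's death. -/

section Paths

variable {D Ω : Type*} [TopologicalSpace D] [MeasurableSpace Ω] (H : HuntProcess D Ω)

/-- The event that the process is alive at time `t`. -/
def alive (t : ℝ≥0) : Set Ω := {ω | H.X t ω ≠ OnePoint.infty}

/-- The event that the process is at time `t` in the subset `B` of `D`. -/
def visits (t : ℝ≥0) (B : Set D) : Set Ω := {ω | H.X t ω ∈ ((↑) : D → OnePoint D) '' B}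

theorem visits_univ (t : ℝ≥0) : H.visits t Set.univ = H.alive t := by
  ext ω
  simp only [visits, alive, Set.mem_ofPred_eq, Set.image_univ]
  rw [← not_iff_not, not_not, OnePoint.notMem_range_coe_iff]

theorem alive_anti : Antitone H.alive := fun s t hst ω h hs => h (H.absorbed ω s t hst hs)

/-- By right-continuity the infimum defining a finite lifetime is attained. -/
theorem lifetime_le_iff [T2Space (OnePoint D)] (ω : Ω) (t : ℝ≥0) :
    H.lifetime ω ≤ t ↔ H.X t ω = OnePoint.infty := by
  refine ⟨fun h => ?_, fun h => iInf₂_le t h⟩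
  have hlt : ∀ s : ℝ≥0, t < s → H.X s ω = OnePoint.infty := fun s hs => by
    have h1 : H.lifetime ω < s := h.trans_lt (by exact_mod_cast hs)
    simp only [lifetime, iInf_lt_iff] at h1
    obtain ⟨r, hr, hrs⟩ := h1
    exact H.absorbed ω r s (by exact_mod_cast hrs.le) hr
  have hc : Tendsto (fun s => H.X s ω) (𝓝[>] t) (𝓝 OnePoint.infty) :=
    tendsto_const_nhds.congr' (eventually_nhdsWithin_of_forall fun s hs => (hlt s hs).symm)
  exact tendsto_nhds_unique (H.right_continuous ω t) hc

theorem lt_lifetime_iff [T2Space (OnePoint D)] (ω : Ω) (t : ℝ≥0) :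
    (t : ℝ≥0∞) < H.lifetime ω ↔ ω ∈ H.alive t := by
  rw [← not_le, H.lifetime_le_iff]; rfl

theorem iUnion_alive_of_tendsto_zero [T2Space (OnePoint D)] {δ : ℕ → ℝ≥0}
    (hδ : Tendsto δ atTop (𝓝 0)) : ⋃ n, H.alive (δ n) = H.alive 0 := by
  refine Set.Subset.antisymm (Set.iUnion_subset fun n => H.alive_anti zero_le) fun ω hω => ?_
  have h0 := (H.lt_lifetime_iff ω 0).2 hω
  have h1 : Tendsto (fun n => (δ n : ℝ≥0∞)) atTop (𝓝 0) := by
    simpa using ENNReal.tendsto_coe.2 hδ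
  obtain ⟨n, hn⟩ := (h1.eventually (gt_mem_nhds (by simpa using h0))).exists
  exact Set.mem_iUnion.2 ⟨n, (H.lt_lifetime_iff ω _).1 hn⟩

/-- The event that the process dies in the `k`-th interval of the grid with mesh `δ`. -/
def diesIn (δ : ℝ≥0) (k : ℕ) : Set Ω := H.alive (k * δ) \ H.alive ((k + 1) * δ)

theorem mem_diesIn_iff [T2Space (OnePoint D)] {ω : Ω} {δ : ℝ≥0} {k : ℕ} :
    ω ∈ H.diesIn δ k ↔ ((k * δ : ℝ≥0) : ℝ≥0∞) < H.lifetime ω ∧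
      H.lifetime ω ≤ (((k + 1) * δ : ℝ≥0) : ℝ≥0∞) := by
  rw [diesIn, Set.mem_sdiff, ← lt_lifetime_iff, ← lt_lifetime_iff, not_lt]

/-- The position of the first particle at the time of death of the second one. -/
noncomputable def atDeath (p : Ω × Ω) : OnePoint D := valueAt H.X (H.lifetime p.2) p.1

/-- Right-continuity keeps the first path in the open set on some `[T, u)`, where `T` is the death
time of the second. If `T` lies in the cell `(kδ, (k+1)δ]`, the next two grid points lie in `[T, T +
2δ)`. Both are recorded because the telescoping sum uses both. -/
theorem eventually_exists_visits_diesIn [T2Space (OnePoint D)] {U : Set D} (hU : IsOpen U)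
    {δ : ℕ → ℝ≥0} (hδ : Tendsto δ atTop (𝓝 0)) (hpos : ∀ n, 0 < δ n) {p : Ω × Ω}
    (hp : 0 < H.lifetime p.2) (hpU : H.atDeath p ∈ ((↑) : D → OnePoint D) '' U) :
    ∀ᶠ n in atTop, ∃ k : ℕ, p.2 ∈ H.diesIn (δ n) k ∧
      p.1 ∈ H.visits ((k + 1) * δ n) U ∧ p.1 ∈ H.visits ((k + 2) * δ n) U := by
  have htop : H.lifetime p.2 ≠ ⊤ := fun h => by
    simp [atDeath, valueAt, h] at hpU
  obtain ⟨T, hT⟩ : ∃ T : ℝ≥0, (T : ℝ≥0∞) = H.lifetime p.2 := WithTop.ne_top_iff_exists.1 htop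
  have hT0 : 0 < T := by rw [← hT] at hp; exact_mod_cast hp
  have hXT : H.X T p.1 ∈ ((↑) : D → OnePoint D) '' U := by
    rw [atDeath, valueAt, if_neg htop, ← hT] at hpU
    simpa using hpU
  have hopen : IsOpen (((↑) : D → OnePoint D) '' U) := OnePoint.isOpen_image_coe.2 hU
  have hc : ∀ᶠ s in 𝓝[≥] T, H.X s p.1 ∈ ((↑) : D → OnePoint D) '' U :=
    (continuousWithinAt_Ioi_iff_Ici.1 (H.right_continuous p.1 T)).eventually
      (hopen.mem_nhds hXT)
  obtain ⟨u, hu, hTu⟩ := mem_nhdsGE_iff_exists_Ico_subset.1 hc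
  have hlim : Tendsto (fun n => T + 2 * δ n) atTop (𝓝 T) := by
    simpa using tendsto_const_nhds.add (hδ.const_mul 2)
  filter_upwards [hlim.eventually (gt_mem_nhds hu)] with n hn
  obtain ⟨k, hk1, hk2⟩ := NNReal.exists_grid_interval hT0 (hpos n)
  refine ⟨k, H.mem_diesIn_iff.2 ⟨?_, ?_⟩, hTu ⟨hk2, ?_⟩, hTu ⟨hk2.trans ?_, ?_⟩⟩
  · rw [← hT]; exact ENNReal.coe_lt_coe.2 hk1
  · rw [← hT]; exact ENNReal.coe_le_coe.2 hk2
  · refine lt_of_le_of_lt ?_ hn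
    calc (k + 1) * δ n ≤ k * δ n + 2 * δ n := by
          rw [add_mul]; gcongr; norm_num
      _ ≤ _ := by gcongr
  · gcongr; norm_num
  · refine lt_of_le_of_lt ?_ hn
    rw [add_mul]; gcongr

theorem exists_mem_diesIn_of_lifetime_eq [T2Space (OnePoint D)] {δ : ℝ≥0} (hδ : 0 < δ)
    {p : Ω × Ω} (h0 : 0 < H.lifetime p.1) (htop : H.lifetime p.1 < ⊤)
    (heq : H.lifetime p.1 = H.lifetime p.2) : ∃ k : ℕ, p ∈ H.diesIn δ k ×ˢ H.diesIn δ k := by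
  obtain ⟨T, hT⟩ : ∃ T : ℝ≥0, (T : ℝ≥0∞) = H.lifetime p.1 :=
    WithTop.ne_top_iff_exists.1 htop.ne
  have hT0 : 0 < T := by rw [← hT] at h0; exact_mod_cast h0
  obtain ⟨k, hk1, hk2⟩ := NNReal.exists_grid_interval hT0 hδ
  refine ⟨k, H.mem_diesIn_iff.2 ?_, H.mem_diesIn_iff.2 ?_⟩
  · rw [← hT]; exact ⟨ENNReal.coe_lt_coe.2 hk1, ENNReal.coe_le_coe.2 hk2⟩
  · rw [← heq, ← hT]; exact ⟨ENNReal.coe_lt_coe.2 hk1, ENNReal.coe_le_coe.2 hk2⟩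

/-- A particle is not at `∂` strictly before its own lifetime, so only a tie produces `∂`. -/
theorem lifetime_eq_of_survivor_eq_infty [T2Space (OnePoint D)] {p : Ω × Ω}
    (h : H.survivor p = OnePoint.infty) : H.lifetime p.1 = H.lifetime p.2 := by
  have key : ∀ ω ω', H.lifetime ω < H.lifetime ω' →
      valueAt H.X (H.lifetime ω) ω' ≠ OnePoint.infty := fun ω ω' hlt hv => by
    obtain ⟨T, hT⟩ : ∃ T : ℝ≥0, (T : ℝ≥0∞) = H.lifetime ω :=
      WithTop.ne_top_iff_exists.1 hlt.ne_top
    rw [valueAt, if_neg hlt.ne_top, ← hT] at hv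
    rw [← hT] at hlt
    exact hlt.not_ge ((H.lifetime_le_iff _ _).2 (by simpa using hv))
  rw [survivor] at h
  split_ifs at h with h1 h2
  · exact absurd h (key _ _ h1)
  · exact absurd h (key _ _ h2)
  · exact le_antisymm (not_lt.1 h1) (not_lt.1 h2)

theorem mem_image_of_survivor_mem {p : Ω × Ω} {B : Set D}
    (h : H.survivor p ∈ ((↑) : D → OnePoint D) '' B) :
    H.atDeath p ∈ ((↑) : D → OnePoint D) '' B ∨
      H.atDeath p.swap ∈ ((↑) : D → OnePoint D) '' B := by
  rw [survivor] at h
  split_ifs at h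
  · exact Or.inl h
  · exact Or.inr h
  · simp at h

end Paths

/-! ### Semigroup property and laws of one or two copies. -/

section Laws

variable {D Ω : Type*} [TopologicalSpace D] [MeasurableSpace Ω] (H : HuntProcess D Ω)

theorem ae_mem_alive_zero (x : D) : ∀ᵐ ω ∂(H.P x), ω ∈ H.alive 0 := by
  filter_upwards [H.normal x] with ω hω
  simp [alive, hω]

theorem alive_infty (t : ℝ≥0) : H.P OnePoint.infty (H.alive t) = 0 := by
  refine measure_mono_null (fun ω hω h0 => hω (H.absorbed ω 0 t zero_le h0))
    (ae_iff.1 (H.normal OnePoint.infty))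

theorem ae_lifetime_pos [T2Space (OnePoint D)] (x : D) : ∀ᵐ ω ∂(H.P x), 0 < H.lifetime ω := by
  filter_upwards [H.ae_mem_alive_zero x] with ω hω
  simpa using (H.lt_lifetime_iff ω 0).2 hω

section Basic

variable [T1Space (OnePoint D)]

theorem measurableSet_alive (t : ℝ≥0) : MeasurableSet (H.alive t) :=
  (H.measurable_X t (measurableSet_singleton _)).compl

theorem measurableSet_diesIn (δ : ℝ≥0) (k : ℕ) : MeasurableSet (H.diesIn δ k) :=
  (H.measurableSet_alive _).diff (H.measurableSet_alive _)

theorem chapmanKolmogorov_alive (x : OnePoint D) (s t : ℝ≥0) :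
    H.P x (H.alive (s + t)) = ∫⁻ ω, H.P (H.X s ω) (H.alive t) ∂(H.P x) := by
  have h := H.strong_markov (fun _ => (s : ℝ≥0∞)) (isStoppingTime_const _ s) Set.univ
    MeasurableSet.univ x t {OnePoint.infty}ᶜ (measurableSet_singleton _).compl
  have h1 : ∀ ω, valueAt H.X (s : ℝ≥0∞) ω = H.X s ω := fun ω => by simp [valueAt]
  have h2 : ∀ ω, valueAt H.X ((s : ℝ≥0∞) + t) ω = H.X (s + t) ω := fun ω => by
    rw [← ENNReal.coe_add]; simp only [valueAt, ENNReal.coe_ne_top, if_false, ENNReal.toNNReal_coe]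
  simp only [h1, h2, ENNReal.coe_lt_top, Set.ofPred_true, Set.univ_inter,
    Measure.restrict_univ] at h
  exact h

/-- The semigroup identity P_s P_t 1 = P_{s+t} 1, from the Markov property at a deterministic time.
-/
theorem transOp_transOp_one (s t : ℝ≥0) (x : D) :
    H.transOp s (fun y => (H.P y).real (H.alive t)) x = (H.P x).real (H.alive (s + t)) := by
  have h : ∀ z : OnePoint D,
      z.elim 0 (fun y : D => (H.P y).real (H.alive t)) = (H.P z (H.alive t)).toReal := fun z => by
    induction z using OnePoint.rec with
    | infty => rw [H.alive_infty]; rfl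
    | coe y => rfl
  simp only [transOp, h]
  have hf : Measurable fun ω => H.P (H.X s ω) (H.alive t) :=
    (Kernel.measurable_coe _ (H.measurableSet_alive t)).comp (H.measurable_X s)
  rw [integral_toReal hf.aemeasurable (Eventually.of_forall fun _ => measure_lt_top _ _),
    measureReal_def, chapmanKolmogorov_alive]

end Basic

variable [MeasurableSpace D] [BorelSpace D]

theorem _root_.OnePoint.measurableEmbedding_coe :
    MeasurableEmbedding ((↑) : D → OnePoint D) :=
  OnePoint.isOpenEmbedding_coe.measurableEmbedding

theorem measurableSet_visits (t : ℝ≥0) {B : Set D} (hB : MeasurableSet B) :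
    MeasurableSet (H.visits t B) :=
  H.measurable_X t (OnePoint.measurableEmbedding_coe.measurableSet_image.2 hB)

theorem measurable_P_coe : Measurable fun x : D => H.P x :=
  H.P.measurable.comp OnePoint.measurableEmbedding_coe.measurable

theorem measurable_P_coe_apply {A : Set Ω} (hA : MeasurableSet A) :
    Measurable fun x : D => H.P x A :=
  (Measure.measurable_coe hA).comp H.measurable_P_coe

theorem measurable_prod_P : Measurable fun z : D × D => (H.P z.1).prod (H.P z.2) := by
  have := (Kernel.parallelComp H.P H.P).measurable.comp
    (OnePoint.measurableEmbedding_coe.measurable.prodMap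
      (OnePoint.measurableEmbedding_coe (D := D)).measurable)
  simpa only [Function.comp_def, Prod.map, Kernel.parallelComp_apply] using this

theorem transOp_indicator (t : ℝ≥0) {B : Set D} (hB : MeasurableSet B) (x : D) :
    H.transOp t (B.indicator 1) x = (H.P x).real (H.visits t B) := by
  rw [← integral_indicator_one (H.measurableSet_visits t hB)]
  refine integral_congr_ae (Eventually.of_forall fun ω => ?_)
  by_cases h : H.X t ω = OnePoint.infty
  · simp [visits, h]
  · obtain ⟨y, hy⟩ := OnePoint.ne_infty_iff_exists.1 h
    by_cases hyB : y ∈ B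
    · simp [visits, ← hy, hyB]
    · simp [visits, ← hy, hyB]

/-- The law of the process whose initial position has distribution `m`. -/
noncomputable def lawFrom (m : Measure D) : Measure Ω := m.bind fun x => H.P x

theorem lawFrom_apply (m : Measure D) {A : Set Ω} (hA : MeasurableSet A) :
    H.lawFrom m A = ∫⁻ x, H.P x A ∂m :=
  Measure.bind_apply hA H.measurable_P_coe.aemeasurable

/-- The law of two independent copies of the process whose initial positions have joint
distribution `μ`. -/
noncomputable def pairLaw (μ : Measure (D × D)) : Measure (Ω × Ω) :=
  (μ.map fun z => ((z.1 : OnePoint D), (z.2 : OnePoint D))).bind (Kernel.parallelComp H.P H.P)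

theorem pairLaw_eq_bind (μ : Measure (D × D)) :
    H.pairLaw μ = μ.bind fun z => (H.P z.1).prod (H.P z.2) := by
  have hc : Measurable fun z : D × D => ((z.1 : OnePoint D), (z.2 : OnePoint D)) :=
    OnePoint.measurableEmbedding_coe.measurable.prodMap
      OnePoint.measurableEmbedding_coe.measurable
  ext A hA
  rw [pairLaw, Measure.bind_apply hA (Kernel.aemeasurable _),
    lintegral_map (Kernel.measurable_coe _ hA) hc,
    Measure.bind_apply hA H.measurable_prod_P.aemeasurable]
  simp only [Kernel.parallelComp_apply]

theorem pairLaw_apply (μ : Measure (D × D)) {A : Set (Ω × Ω)} (hA : MeasurableSet A) :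
    H.pairLaw μ A = ∫⁻ z, (H.P z.1).prod (H.P z.2) A ∂μ := by
  rw [pairLaw_eq_bind, Measure.bind_apply hA H.measurable_prod_P.aemeasurable]

/-- The law of two independent copies of the process with the same initial position, which has
distribution `m`. -/
noncomputable def diagLaw (m : Measure D) : Measure (Ω × Ω) := H.pairLaw (m.map fun x => (x, x))

theorem diagLaw_apply (m : Measure D) {A : Set (Ω × Ω)} (hA : MeasurableSet A) :
    H.diagLaw m A = ∫⁻ x, (H.P x).prod (H.P x) A ∂m := by
  have hf : Measurable fun z : D × D => (H.P z.1).prod (H.P z.2) A :=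
    (Measure.measurable_coe hA).comp H.measurable_prod_P
  rw [diagLaw, pairLaw_apply _ _ hA, lintegral_map hf (by fun_prop)]

theorem diagLaw_prod (m : Measure D) {A B : Set Ω} (hA : MeasurableSet A) (hB : MeasurableSet B) :
    H.diagLaw m (A ×ˢ B) = ∫⁻ x, H.P x A * H.P x B ∂m := by
  simp only [diagLaw_apply H m (hA.prod hB), Measure.prod_prod]

theorem lawFrom_univ (m : Measure D) : H.lawFrom m Set.univ = m Set.univ := by
  rw [lawFrom_apply _ _ MeasurableSet.univ]; simp

theorem diagLaw_swap (m : Measure D) : (H.diagLaw m).map Prod.swap = H.diagLaw m := by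
  ext A hA
  rw [Measure.map_apply measurable_swap hA, diagLaw_apply _ _ (measurable_swap hA),
    diagLaw_apply _ _ hA]
  refine lintegral_congr fun x => ?_
  rw [← Measure.map_apply measurable_swap hA, Measure.prod_swap]

variable (m : Measure D) [IsFiniteMeasure m]

instance : IsFiniteMeasure (H.lawFrom m) :=
  ⟨by rw [lawFrom_apply _ _ MeasurableSet.univ]; simp⟩

instance (μ : Measure (D × D)) [IsFiniteMeasure μ] : IsFiniteMeasure (H.pairLaw μ) :=
  ⟨by rw [pairLaw_apply _ _ MeasurableSet.univ]; simp⟩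

instance : IsFiniteMeasure (H.diagLaw m) := by unfold diagLaw; infer_instance

theorem pairLaw_prod : H.pairLaw (m.prod m) = (H.lawFrom m).prod (H.lawFrom m) := by
  refine (Measure.prod_eq fun A B hA hB => ?_).symm
  rw [pairLaw_apply _ _ (hA.prod hB), lawFrom_apply _ _ hA, lawFrom_apply _ _ hB,
    ← lintegral_prod_mul (H.measurable_P_coe_apply hA).aemeasurable
      (H.measurable_P_coe_apply hB).aemeasurable]
  simp only [Measure.prod_prod]

end Laws

/-! ### Consequences of self-duality. -/

section SelfDual

variable {D Ω : Type*} [TopologicalSpace D] [T2Space D]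
  [MeasurableSpace D] [BorelSpace D] [MeasurableSpace Ω] {H : HuntProcess D Ω}
  {m : Measure D} [IsFiniteMeasure m]

/-- Self-adjointness of P_s applied to 1_B and P_t 1, both in L² because `m` is finite. The rest
passes from real to extended nonnegative integrals. -/
theorem IsSelfDual.lintegral_visits_mul_alive (hm : H.IsSelfDual m) (s t : ℝ≥0) {B : Set D}
    (hB : MeasurableSet B) :
    ∫⁻ x, H.P x (H.visits s B) * H.P x (H.alive t) ∂m =
      ∫⁻ x in B, H.P x (H.alive (s + t)) ∂m := by
  have hg : Measurable fun x : D => (H.P x).real (H.alive t) :=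
    (H.measurable_P_coe_apply (H.measurableSet_alive t)).ennreal_toReal
  have hst : Measurable fun x : D => (H.P x).real (H.alive (s + t)) :=
    (H.measurable_P_coe_apply (H.measurableSet_alive _)).ennreal_toReal
  have hv : Measurable fun x : D => (H.P x).real (H.visits s B) :=
    (H.measurable_P_coe_apply (H.measurableSet_visits s hB)).ennreal_toReal
  have hbd : ∀ A : Set Ω, ∀ x : D, ‖(H.P x).real A‖ ≤ 1 := fun A x => by
    rw [Real.norm_of_nonneg measureReal_nonneg]; exact measureReal_le_one
  have h := hm s (B.indicator 1) (fun x => (H.P x).real (H.alive t))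
    (measurable_one.indicator hB) hg ((memLp_const 1).indicator hB)
    (MemLp.of_bound hg.aestronglyMeasurable 1 (Eventually.of_forall (hbd _)))
  simp only [transOp_indicator, hB, transOp_transOp_one] at h
  have h1 : ∀ x : D, B.indicator (1 : D → ℝ) x * (H.P x).real (H.alive (s + t)) =
      B.indicator (fun x => (H.P x).real (H.alive (s + t))) x := fun x => by
    by_cases hx : x ∈ B <;> simp [hx]
  simp only [h1] at h
  rw [integral_indicator hB] at h
  have h2 := congrArg ENNReal.ofReal h
  rw [ofReal_integral_eq_lintegral_ofReal, ofReal_integral_eq_lintegral_ofReal] at h2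
  · have h3 : ∀ (x : D) (A : Set Ω), ENNReal.ofReal ((H.P x).real A) = H.P x A := fun _ _ =>
      ofReal_measureReal
    simpa only [ENNReal.ofReal_mul measureReal_nonneg, h3] using h2
  · exact (Integrable.of_bound hst.aestronglyMeasurable 1
      (Eventually.of_forall (hbd _)))
  · exact Eventually.of_forall fun _ => measureReal_nonneg
  · refine Integrable.of_bound (hv.mul hg).aestronglyMeasurable 1
      (Eventually.of_forall fun x => ?_)
    rw [norm_mul]
    exact mul_le_one₀ (hbd _ _) (norm_nonneg _) (hbd _ _)
  · exact Eventually.of_forall fun _ => mul_nonneg measureReal_nonneg measureReal_nonneg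

theorem IsSelfDual.diagLaw_visits_prod_alive (hm : H.IsSelfDual m) (s t : ℝ≥0) {B : Set D}
    (hB : MeasurableSet B) :
    H.diagLaw m (H.visits s B ×ˢ H.alive t) = ∫⁻ x in B, H.P x (H.alive (s + t)) ∂m := by
  rw [diagLaw_prod _ _ (H.measurableSet_visits s hB) (H.measurableSet_alive t),
    hm.lintegral_visits_mul_alive s t hB]

/-- The case `t = 0` of the duality identity: `m` is excessive. -/
theorem IsSelfDual.lawFrom_visits_le (hm : H.IsSelfDual m) (s : ℝ≥0) {B : Set D}
    (hB : MeasurableSet B) : H.lawFrom m (H.visits s B) ≤ m B := by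
  have h0 : ∀ x : D, H.P x (H.alive 0) = 1 := fun x =>
    (mem_ae_iff_prob_eq_one (H.measurableSet_alive 0)).1 (H.ae_mem_alive_zero x)
  have h := hm.lintegral_visits_mul_alive s 0 hB
  simp only [h0, mul_one] at h
  rw [lawFrom_apply _ _ (H.measurableSet_visits s hB), h]
  calc ∫⁻ x in B, H.P x (H.alive (s + 0)) ∂m ≤ ∫⁻ _ in B, 1 ∂m :=
        lintegral_mono fun _ => prob_le_one
    _ = m B := by simp

theorem IsSelfDual.diagLaw_alive_prod_alive (hm : H.IsSelfDual m) (s t : ℝ≥0) :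
    (H.diagLaw m).real (H.alive s ×ˢ H.alive t) = (H.lawFrom m).real (H.alive (s + t)) := by
  rw [measureReal_def, measureReal_def, ← H.visits_univ s,
    hm.diagLaw_visits_prod_alive s t MeasurableSet.univ, Measure.restrict_univ,
    lawFrom_apply _ _ (H.measurableSet_alive _)]

end SelfDual

/-! ### Subinvariance of `m` for the survivor position. -/

section Occupation

variable {D Ω : Type*} [TopologicalSpace D] [T2Space D]
  [MeasurableSpace D] [BorelSpace D] [MeasurableSpace Ω] {H : HuntProcess D Ω}
  {m : Measure D} [IsFiniteMeasure m]

theorem IsSelfDual.diagLaw_visits_prod_diesIn_add (hm : H.IsSelfDual m) (s δ : ℝ≥0) (k : ℕ)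
    {B : Set D} (hB : MeasurableSet B) :
    H.diagLaw m (H.visits s B ×ˢ H.diesIn δ k) + ∫⁻ x in B, H.P x (H.alive (s + (k + 1) * δ)) ∂m =
      ∫⁻ x in B, H.P x (H.alive (s + k * δ)) ∂m := by
  have hsub : H.alive ((k + 1) * δ) ⊆ H.alive (k * δ) :=
    H.alive_anti (by gcongr; exact le_self_add)
  rw [← hm.diagLaw_visits_prod_alive s _ hB, ← hm.diagLaw_visits_prod_alive s _ hB, diesIn,
    ← measure_union, ← Set.prod_union, Set.sdiff_union_of_subset hsub]
  · exact Set.disjoint_prod.2 (Or.inr Set.disjoint_sdiff_left)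
  · exact (H.measurableSet_visits s hB).prod (H.measurableSet_alive _)

/-- Evaluation at `(k+1)δ` gives the increment of `a` from `(2k+1)δ` to `(2k+2)δ`, and at `(k+2)δ`
the one from `(2k+2)δ` to `(2k+3)δ`. Together they tile the half-line from `δ` without overlap. -/
theorem IsSelfDual.sum_diagLaw_visits_prod_diesIn (hm : H.IsSelfDual m) (δ : ℝ≥0) {B : Set D}
    (hB : MeasurableSet B) (N : ℕ) :
    ∑ k ∈ Finset.range N, (H.diagLaw m (H.visits ((k + 1) * δ) B ×ˢ H.diesIn δ k) +
      H.diagLaw m (H.visits ((k + 2) * δ) B ×ˢ H.diesIn δ k)) +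
        ∫⁻ x in B, H.P x (H.alive ((2 * N + 1) * δ)) ∂m = ∫⁻ x in B, H.P x (H.alive δ) ∂m := by
  induction N with
  | zero => simp
  | succ N ih =>
    have h1 := hm.diagLaw_visits_prod_diesIn_add ((N + 1) * δ) δ N hB
    have h2 := hm.diagLaw_visits_prod_diesIn_add ((N + 2) * δ) δ N hB
    have e1 : (N + 1) * δ + N * δ = (2 * N + 1) * δ := by ring
    have e2 : (N + 2) * δ + N * δ = (N + 1) * δ + (N + 1) * δ := by ring
    have e3 : (2 * ((N + 1 : ℕ) : ℝ≥0) + 1) * δ = (N + 2) * δ + (N + 1) * δ := by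
      push_cast; ring
    rw [e1] at h1
    rw [e2] at h2
    rw [Finset.sum_range_succ, e3, add_assoc, add_assoc _ _ (∫⁻ x in B, _ ∂m), h2, h1, ih]

theorem IsSelfDual.tsum_diagLaw_visits_prod_diesIn_le (hm : H.IsSelfDual m) (δ : ℝ≥0) {B : Set D}
    (hB : MeasurableSet B) :
    ∑' k : ℕ, H.diagLaw m (H.visits ((k + 1) * δ) B ×ˢ H.diesIn δ k) +
      ∑' k : ℕ, H.diagLaw m (H.visits ((k + 2) * δ) B ×ˢ H.diesIn δ k) ≤ m B := by
  rw [← ENNReal.tsum_add]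
  refine ENNReal.tsum_le_of_sum_range_le fun N => ?_
  calc _ ≤ ∫⁻ x in B, H.P x (H.alive δ) ∂m :=
        le_self_add.trans (hm.sum_diagLaw_visits_prod_diesIn δ hB N).le
    _ ≤ ∫⁻ _ in B, 1 ∂m := lintegral_mono fun _ => prob_le_one
    _ = m B := by simp

variable [LocallyCompactSpace D]

theorem tendsto_one_div_add_atTop_nhds_zero :
    Tendsto (fun n : ℕ => 1 / ((n : ℝ≥0) + 1)) atTop (𝓝 0) :=
  tendsto_one_div_add_atTop_nhds_zero_nat (𝕜 := ℝ≥0)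

theorem ae_diagLaw_lifetime_pos (H : HuntProcess D Ω) (m : Measure D) :
    ∀ᵐ p ∂(H.diagLaw m), 0 < H.lifetime p.1 ∧ 0 < H.lifetime p.2 := by
  have hl := H.measurable_lifetime
  have hs : MeasurableSet {ω | ¬ 0 < H.lifetime ω} := (measurableSet_lt measurable_const hl).compl
  have h0 : ∀ x : D, H.P x {ω | ¬ 0 < H.lifetime ω} = 0 := fun x =>
    ae_iff.1 (H.ae_lifetime_pos x)
  have h1 : H.diagLaw m ({ω | ¬ 0 < H.lifetime ω} ×ˢ Set.univ) = 0 := by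
    rw [diagLaw_prod _ _ hs MeasurableSet.univ]; simp only [h0, zero_mul, lintegral_zero]
  have h2 : H.diagLaw m (Set.univ ×ˢ {ω | ¬ 0 < H.lifetime ω}) = 0 := by
    rw [diagLaw_prod _ _ MeasurableSet.univ hs]; simp only [h0, mul_zero, lintegral_zero]
  refine Filter.Eventually.and (ae_iff.2 ?_) (ae_iff.2 ?_)
  · exact measure_mono_null (fun p hp => Set.mk_mem_prod hp (Set.mem_univ p.2)) h1
  · exact measure_mono_null (fun p hp => Set.mk_mem_prod (Set.mem_univ p.1) hp) h2

/-- The event eventually lies in both grid events, whose probabilities sum to at most `m U`; this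
gives the factor 2. That factor later absorbs the choice of which particle survives. -/
theorem IsSelfDual.diagLaw_atDeath_le_of_isOpen (hm : H.IsSelfDual m) {U : Set D}
    (hU : IsOpen U) :
    2 * H.diagLaw m {p | H.atDeath p ∈ ((↑) : D → OnePoint D) '' U} ≤ m U := by
  have hUm := hU.measurableSet
  let δ : ℕ → ℝ≥0 := fun n => 1 / ((n : ℝ≥0) + 1)
  have hδ : ∀ n, 0 < δ n := fun n => by positivity
  let F : ℕ → Set (Ω × Ω) := fun n =>
    {p | ∃ k : ℕ, p.2 ∈ H.diesIn (δ n) k ∧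
      p.1 ∈ H.visits ((k + 1) * δ n) U ∧ p.1 ∈ H.visits ((k + 2) * δ n) U}
  have hF : ∀ n, H.diagLaw m (F n) ≤ m U / 2 := fun n => by
    rw [ENNReal.le_div_iff_mul_le (by simp) (by simp), mul_two]
    refine le_trans (add_le_add ?_ ?_) (hm.tsum_diagLaw_visits_prod_diesIn_le (δ n) hUm)
    · refine (measure_mono ?_).trans (measure_iUnion_le _)
      rintro p ⟨k, h1, h2, -⟩
      exact Set.mem_iUnion.2 ⟨k, h2, h1⟩
    · refine (measure_mono ?_).trans (measure_iUnion_le _)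
      rintro p ⟨k, h1, -, h3⟩
      exact Set.mem_iUnion.2 ⟨k, h3, h1⟩
  have hE : H.diagLaw m {p | H.atDeath p ∈ ((↑) : D → OnePoint D) '' U} ≤
      H.diagLaw m {p | 0 < H.lifetime p.2 ∧ H.atDeath p ∈ ((↑) : D → OnePoint D) '' U} := by
    refine measure_mono_ae ?_
    filter_upwards [H.ae_diagLaw_lifetime_pos m] with p hp hpU
    exact ⟨hp.2, hpU⟩
  have h := hE.trans (measure_le_liminf_of_eventually_mem (fun p hp =>
    H.eventually_exists_visits_diesIn hU tendsto_one_div_add_atTop_nhds_zero hδ hp.1 hp.2) hF)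
  rw [liminf_const, ENNReal.le_div_iff_mul_le (by simp) (by simp)] at h
  rwa [mul_comm]

theorem measurable_valueAt {D Ω : Type*} [TopologicalSpace D] [LocallyCompactSpace D] [T2Space D]
    [SecondCountableTopology D] [MeasurableSpace Ω] (H : HuntProcess D Ω) :
    Measurable fun q : ℝ≥0∞ × Ω => valueAt H.X q.1 q.2 :=
  Measurable.ite (measurable_fst (measurableSet_singleton ⊤)) measurable_const
    (H.measurable_uncurry_X.comp
      ((ENNReal.measurable_toNNReal.comp measurable_fst).prodMk measurable_snd))

theorem measurable_atDeath {D Ω : Type*} [TopologicalSpace D] [LocallyCompactSpace D] [T2Space D]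
    [SecondCountableTopology D] [MeasurableSpace Ω] (H : HuntProcess D Ω) : Measurable H.atDeath :=
  H.measurable_valueAt.comp ((H.measurable_lifetime.comp measurable_snd).prodMk measurable_fst)

variable [SecondCountableTopology D]

/-- Outer regularity of `m` extends the bound from open sets. -/
theorem IsSelfDual.diagLaw_atDeath_le (hm : H.IsSelfDual m) (B : Set D) :
    2 * H.diagLaw m {p | H.atDeath p ∈ ((↑) : D → OnePoint D) '' B} ≤ m B := by
  rw [Set.measure_eq_iInf_isOpen B m]
  refine le_iInf₂ fun U hBU => le_iInf fun hU => le_trans ?_ (hm.diagLaw_atDeath_le_of_isOpen hU)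
  gcongr

theorem survivor_le_of_swap {ρ : Measure (Ω × Ω)} (hρ : ρ.map Prod.swap = ρ) {B : Set D}
    (hB : MeasurableSet B) :
    ρ {p | H.survivor p ∈ ((↑) : D → OnePoint D) '' B} ≤
      2 * ρ {p | H.atDeath p ∈ ((↑) : D → OnePoint D) '' B} := by
  have hE : MeasurableSet {p | H.atDeath p ∈ ((↑) : D → OnePoint D) '' B} :=
    H.measurable_atDeath (OnePoint.measurableEmbedding_coe.measurableSet_image.2 hB)
  calc _ ≤ ρ ({p | H.atDeath p ∈ ((↑) : D → OnePoint D) '' B} ∪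
        Prod.swap ⁻¹' {p | H.atDeath p ∈ ((↑) : D → OnePoint D) '' B}) :=
        measure_mono fun p hp => H.mem_image_of_survivor_mem hp
    _ ≤ _ := measure_union_le _ _
    _ = _ := by rw [← Measure.map_apply measurable_swap hE, hρ, two_mul]

theorem IsSelfDual.diagLaw_survivor_le (hm : H.IsSelfDual m) {B : Set D} (hB : MeasurableSet B) :
    H.diagLaw m {p | H.survivor p ∈ ((↑) : D → OnePoint D) '' B} ≤ m B :=
  (survivor_le_of_swap (H.diagLaw_swap m) hB).trans (hm.diagLaw_atDeath_le B)

/-- Given the second path, its death time is a fixed time for the independent first path, so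
excessiveness of `m` applies. -/
theorem IsSelfDual.prod_atDeath_le (hm : H.IsSelfDual m) {B : Set D} (hB : MeasurableSet B) :
    (H.lawFrom m).prod (H.lawFrom m) {p | H.atDeath p ∈ ((↑) : D → OnePoint D) '' B} ≤
      m Set.univ * m B := by
  have hE : MeasurableSet {p | H.atDeath p ∈ ((↑) : D → OnePoint D) '' B} :=
    H.measurable_atDeath (OnePoint.measurableEmbedding_coe.measurableSet_image.2 hB)
  rw [Measure.prod_apply_symm hE]
  calc _ ≤ ∫⁻ _, m B ∂(H.lawFrom m) := lintegral_mono fun ω => by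
        by_cases h : H.lifetime ω = ⊤
        · simp [atDeath, valueAt, h]
        · refine le_trans (measure_mono fun ω' hω' => ?_)
            (hm.lawFrom_visits_le (H.lifetime ω).toNNReal hB)
          simpa [atDeath, valueAt, h, visits] using hω'
    _ = m Set.univ * m B := by rw [lintegral_const, lawFrom_univ, mul_comm]

theorem IsSelfDual.pairLaw_survivor_le (hm : H.IsSelfDual m) {B : Set D} (hB : MeasurableSet B) :
    H.pairLaw (m.prod m) {p | H.survivor p ∈ ((↑) : D → OnePoint D) '' B} ≤
      2 * m Set.univ * m B := by
  rw [pairLaw_prod, mul_assoc]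
  refine (survivor_le_of_swap Measure.prod_swap hB).trans ?_
  gcongr
  exact hm.prod_atDeath_le hB

end Occupation

/-! ### The survival function on the grid. -/

section Survival

variable {D Ω : Type*} [TopologicalSpace D] [MeasurableSpace D] [MeasurableSpace Ω]
  (H : HuntProcess D Ω) (m : Measure D)

/-- The total mass of the process started from `m` and alive at the `i`-th grid point. -/
noncomputable def survival (δ : ℝ≥0) (i : ℕ) : ℝ :=
  (H.lawFrom m).real (H.alive (i * δ))

theorem survival_nonneg (δ : ℝ≥0) (i : ℕ) : 0 ≤ H.survival m δ i := measureReal_nonneg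

variable [BorelSpace D] [IsFiniteMeasure m]

theorem survival_succ_le (δ : ℝ≥0) (i : ℕ) : H.survival m δ (i + 1) ≤ H.survival m δ i :=
  measureReal_mono (H.alive_anti (by gcongr; omega))

theorem lawFrom_diesIn [T1Space (OnePoint D)] (δ : ℝ≥0) (k : ℕ) : (H.lawFrom m).real (H.diesIn δ k) = H.survival m δ k - H.survival m δ (k + 1) := by
  have hsub : H.alive ((k + 1) * δ) ⊆ H.alive (k * δ) :=
    H.alive_anti (by gcongr; exact le_self_add)
  rw [diesIn, measureReal_sdiff hsub (H.measurableSet_alive _)]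
  simp [survival]

end Survival

/-! ### Simultaneous deaths are negligible. -/

section Simultaneous

variable {D Ω : Type*} [TopologicalSpace D] [T2Space D]
  [MeasurableSpace D] [BorelSpace D] [MeasurableSpace Ω] {H : HuntProcess D Ω}
  {m : Measure D} [IsFiniteMeasure m]

/-- By duality the probability that both copies are alive, at `s` and `t`, depends only on `s + t`;
inclusion-exclusion then yields a second difference. -/
theorem IsSelfDual.diagLaw_diesIn_prod_diesIn (hm : H.IsSelfDual m) (δ : ℝ≥0) (i j : ℕ) :
    (H.diagLaw m).real (H.diesIn δ i ×ˢ H.diesIn δ j) =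
      H.survival m δ (i + j) - 2 * H.survival m δ (i + j + 1) + H.survival m δ (i + j + 2) := by
  have hsub : ∀ k : ℕ, H.alive ((k + 1) * δ) ⊆ H.alive (k * δ) := fun k =>
    H.alive_anti (by gcongr; exact le_self_add)
  have hmeas := H.measurableSet_alive
  have h1 : ∀ s, (H.diagLaw m).real (H.alive s ×ˢ H.diesIn δ j) =
      (H.lawFrom m).real (H.alive (s + j * δ)) - (H.lawFrom m).real (H.alive (s + (j + 1) * δ)) :=
    fun s => by
      have e : H.alive s ×ˢ H.diesIn δ j =
          H.alive s ×ˢ H.alive (j * δ) \ H.alive s ×ˢ H.alive ((j + 1) * δ) := by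
        simp [Set.prod_sdiff_prod, diesIn]
      rw [e, measureReal_sdiff (Set.prod_mono_right (hsub j))
        ((hmeas _).prod (hmeas _)), hm.diagLaw_alive_prod_alive, hm.diagLaw_alive_prod_alive]
  have h2 : (H.diagLaw m).real (H.diesIn δ i ×ˢ H.diesIn δ j) =
      (H.diagLaw m).real (H.alive (i * δ) ×ˢ H.diesIn δ j) -
        (H.diagLaw m).real (H.alive ((i + 1) * δ) ×ˢ H.diesIn δ j) := by
    have e : H.diesIn δ i ×ˢ H.diesIn δ j =
        H.alive (i * δ) ×ˢ H.diesIn δ j \ H.alive ((i + 1) * δ) ×ˢ H.diesIn δ j := by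
      rw [Set.prod_sdiff_prod]; simp [diesIn]
    rw [e, measureReal_sdiff (Set.prod_mono_left (hsub i))
        ((hmeas _).prod (H.measurableSet_diesIn δ j))]
  have e0 : ((i + j : ℕ) : ℝ≥0) * δ = i * δ + j * δ := by push_cast; ring
  have e1 : ((i + j + 1 : ℕ) : ℝ≥0) * δ = i * δ + (j + 1) * δ := by push_cast; ring
  have e1' : ((i + 1 : ℝ≥0)) * δ + j * δ = i * δ + (j + 1) * δ := by ring
  have e2 : ((i + j + 2 : ℕ) : ℝ≥0) * δ = (i + 1) * δ + (j + 1) * δ := by push_cast; ring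
  rw [h2, h1, h1, survival, survival, survival, e0, e1, e2, e1']
  ring

/-- Second differences are probabilities up to mass, hence nonnegative: survival is convex. -/
theorem IsSelfDual.survival_sub_le (hm : H.IsSelfDual m) (δ : ℝ≥0) (k : ℕ) :
    H.survival m δ k - H.survival m δ (k + 1) ≤ H.survival m δ 0 - H.survival m δ 1 := by
  induction k with
  | zero => simp
  | succ k ih =>
    have h := hm.diagLaw_diesIn_prod_diesIn δ k 0
    have h0 : 0 ≤ (H.diagLaw m).real (H.diesIn δ k ×ˢ H.diesIn δ 0) := measureReal_nonneg
    simp only [add_zero] at h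
    linarith

theorem IsSelfDual.sum_diagLaw_diesIn_le (hm : H.IsSelfDual m) (δ : ℝ≥0) (N : ℕ) :
    ∑ k ∈ Finset.range N, (H.diagLaw m).real (H.diesIn δ k ×ˢ H.diesIn δ k) ≤
      H.survival m δ 0 - H.survival m δ 1 := by
  -- Strengthened for induction: the diagonal term drops the decrement from index `2N` to `2N+1`,
  -- and the nonnegative `(N, N+1)` term carries it on to `2N+2`.
  suffices h : ∑ k ∈ Finset.range N, (H.diagLaw m).real (H.diesIn δ k ×ˢ H.diesIn δ k) ≤
      H.survival m δ 0 - H.survival m δ 1 -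
        (H.survival m δ (2 * N) - H.survival m δ (2 * N + 1)) from
    h.trans (sub_le_self _ (sub_nonneg.2 (H.survival_succ_le m δ _)))
  induction N with
  | zero => simp
  | succ N ih =>
    have h1 := hm.diagLaw_diesIn_prod_diesIn δ N N
    have h2 := hm.diagLaw_diesIn_prod_diesIn δ N (N + 1)
    have h0 : 0 ≤ (H.diagLaw m).real (H.diesIn δ N ×ˢ H.diesIn δ (N + 1)) := measureReal_nonneg
    have e : N + N = 2 * N := by ring
    have e' : N + (N + 1) = 2 * N + 1 := by ring
    have e2 : 2 * (N + 1) = 2 * N + 2 := by ring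
    rw [e] at h1
    rw [e'] at h2
    rw [Finset.sum_range_succ, e2]
    linarith

/-- Each term is the square of a decrement; one factor is bounded by the first decrement and the
other telescopes. -/
theorem IsSelfDual.sum_prod_diesIn_le (hm : H.IsSelfDual m) (δ : ℝ≥0) (N : ℕ) :
    ∑ k ∈ Finset.range N,
      ((H.lawFrom m).prod (H.lawFrom m)).real (H.diesIn δ k ×ˢ H.diesIn δ k) ≤
      (H.survival m δ 0 - H.survival m δ 1) * m.real Set.univ := by
  have hd : 0 ≤ H.survival m δ 0 - H.survival m δ 1 := sub_nonneg.2 (H.survival_succ_le m δ 0)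
  calc _ ≤ ∑ k ∈ Finset.range N, (H.survival m δ 0 - H.survival m δ 1) *
        (H.survival m δ k - H.survival m δ (k + 1)) := Finset.sum_le_sum fun k _ => by
        rw [measureReal_prod_prod, lawFrom_diesIn]
        exact mul_le_mul_of_nonneg_right (hm.survival_sub_le δ k)
          (sub_nonneg.2 (H.survival_succ_le m δ k))
    _ = (H.survival m δ 0 - H.survival m δ 1) * (H.survival m δ 0 - H.survival m δ N) := by
        rw [← Finset.mul_sum, Finset.sum_range_sub']
    _ ≤ _ := by
        refine mul_le_mul_of_nonneg_left ?_ hd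
        have h : H.survival m δ 0 ≤ m.real Set.univ := by
          rw [survival, measureReal_def, measureReal_def, ← H.lawFrom_univ m]
          exact measureReal_mono (Set.subset_univ _)
        linarith [H.survival_nonneg m δ N]

variable [LocallyCompactSpace D]

theorem tendsto_survival_sub (H : HuntProcess D Ω) (m : Measure D) [IsFiniteMeasure m] :
    Tendsto (fun n : ℕ => H.survival m (1 / ((n : ℝ≥0) + 1)) 0 -
      H.survival m (1 / ((n : ℝ≥0) + 1)) 1) atTop (𝓝 0) := by
  have hmono : Monotone fun n : ℕ => H.alive (1 / ((n : ℝ≥0) + 1)) := fun n k hnk =>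
    H.alive_anti (one_div_le_one_div_of_le (by positivity) (by gcongr))
  have h := tendsto_measure_iUnion_atTop (μ := H.lawFrom m) hmono
  rw [H.iUnion_alive_of_tendsto_zero tendsto_one_div_add_atTop_nhds_zero] at h
  have h' := ((ENNReal.tendsto_toReal (measure_ne_top _ _)).comp h).const_sub
    ((H.lawFrom m).real (H.alive 0))
  simpa [survival, measureReal_def, Function.comp_def] using h'

/-- Positive finite equal lifetimes put both paths in the same cell for every mesh, and the first
survival decrement tends to 0. -/
theorem measure_simultaneous_death_eq_zero {ρ : Measure (Ω × Ω)} [IsFiniteMeasure ρ]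
    (hρ : ∀ᵐ p ∂ρ, 0 < H.lifetime p.1) (c : ℝ)
    (h : ∀ (δ : ℝ≥0) (N : ℕ), ∑ k ∈ Finset.range N, ρ.real (H.diesIn δ k ×ˢ H.diesIn δ k) ≤
      (H.survival m δ 0 - H.survival m δ 1) * c) :
    ∀ᵐ p ∂ρ, H.firstDeath p < ⊤ → H.survivor p ≠ OnePoint.infty := by
  let δ : ℕ → ℝ≥0 := fun n => 1 / ((n : ℝ≥0) + 1)
  have hδ : ∀ n, 0 < δ n := fun n => by positivity
  have hnull : ρ {p | 0 < H.lifetime p.1 ∧ H.lifetime p.1 < ⊤ ∧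
      H.lifetime p.1 = H.lifetime p.2} = 0 := by
    refine measure_eq_zero_of_eventually_mem
      (F := fun n => ⋃ k, H.diesIn (δ n) k ×ˢ H.diesIn (δ n) k)
      (c := fun n => ENNReal.ofReal ((H.survival m (δ n) 0 - H.survival m (δ n) 1) * c))
      (fun p hp => Eventually.of_forall fun n => ?_) (fun n => ?_) ?_
    · exact Set.mem_iUnion.2 (H.exists_mem_diesIn_of_lifetime_eq (hδ n) hp.1 hp.2.1 hp.2.2)
    · refine (measure_iUnion_le _).trans (ENNReal.tsum_le_of_sum_range_le fun N => ?_)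
      calc _ = ENNReal.ofReal (∑ k ∈ Finset.range N,
            ρ.real (H.diesIn (δ n) k ×ˢ H.diesIn (δ n) k)) := by
            rw [ENNReal.ofReal_sum_of_nonneg fun _ _ => measureReal_nonneg]
            exact Finset.sum_congr rfl fun k _ => (ofReal_measureReal (measure_ne_top _ _)).symm
        _ ≤ _ := ENNReal.ofReal_le_ofReal (h _ _)
    · have := ENNReal.tendsto_ofReal ((H.tendsto_survival_sub m).mul_const c)
      simpa only [zero_mul, ENNReal.ofReal_zero] using this
  have hae : ∀ᵐ p ∂ρ, ¬ (0 < H.lifetime p.1 ∧ H.lifetime p.1 < ⊤ ∧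
      H.lifetime p.1 = H.lifetime p.2) := by
    rw [ae_iff]; simpa only [not_not] using hnull
  filter_upwards [hρ, hae] with p hp1 hp2 hfin hsurv
  have heq := H.lifetime_eq_of_survivor_eq_infty hsurv
  refine hp2 ⟨hp1, ?_, heq⟩
  simpa [firstDeath, ← heq] using hfin

theorem IsSelfDual.ae_diagLaw_survivor_ne (hm : H.IsSelfDual m) :
    ∀ᵐ p ∂(H.diagLaw m), H.firstDeath p < ⊤ → H.survivor p ≠ OnePoint.infty :=
  measure_simultaneous_death_eq_zero (m := m)
    ((H.ae_diagLaw_lifetime_pos m).mono fun _ h => h.1) 1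
    fun δ N => by simpa using hm.sum_diagLaw_diesIn_le δ N

theorem IsSelfDual.ae_pairLaw_survivor_ne (hm : H.IsSelfDual m) :
    ∀ᵐ p ∂(H.pairLaw (m.prod m)), H.firstDeath p < ⊤ → H.survivor p ≠ OnePoint.infty := by
  rw [pairLaw_prod]
  refine measure_simultaneous_death_eq_zero (m := m) ?_ (m.real Set.univ) hm.sum_prod_diesIn_le
  have hs : MeasurableSet {ω | ¬ 0 < H.lifetime ω} :=
    (measurableSet_lt measurable_const H.measurable_lifetime).compl
  have h0 : H.lawFrom m {ω | ¬ 0 < H.lifetime ω} = 0 := by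
    rw [lawFrom_apply _ _ hs]
    simp only [fun x : D => ae_iff.1 (H.ae_lifetime_pos x), lintegral_zero]
  exact Measure.quasiMeasurePreserving_fst.ae (ae_iff.2 h0)

end Simultaneous

end HuntProcess

/-! ### Trajectory measures with finite, unnormalised initial measure. -/

namespace ProbabilityTheory.Kernel

open Finset Preorder

variable {E : Type*} [MeasurableSpace E] {κ : (n : ℕ) → Kernel (Π _ : Iic n, E) E}
  [∀ n, IsMarkovKernel (κ n)]

theorem trajMeasure_eq_bind (μ₀ : Measure E) :
    trajMeasure (X := fun _ => E) μ₀ κ = (μ₀.map (MeasurableEquiv.piUnique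
      fun _ : Iic 0 => E).symm).bind (traj (X := fun _ => E) κ 0) := rfl

theorem isFiniteMeasure_trajMeasure (μ₀ : Measure E) [IsFiniteMeasure μ₀] :
    IsFiniteMeasure (trajMeasure (X := fun _ => E) μ₀ κ) := by
  rw [trajMeasure_eq_bind]; infer_instance

theorem trajMeasure_map_prod (μ₀ : Measure E) [IsFiniteMeasure μ₀] (n : ℕ) :
    (trajMeasure (X := fun _ => E) μ₀ κ).map (fun x => (frestrictLe n x, x (n + 1))) =
      (trajMeasure (X := fun _ => E) μ₀ κ).map (frestrictLe n) ⊗ₘ κ n := by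
  have := isFiniteMeasure_trajMeasure (κ := κ) μ₀
  rw [Measure.compProd_eq_comp_prod, trajMeasure_eq_bind, Measure.map_comp _ _ (by fun_prop),
    Measure.map_comp _ _ (by fun_prop), traj_map_frestrictLe, Measure.comp_assoc]
  congr with x₀ : 1
  rw [comp_apply, ← Measure.compProd_eq_comp_prod, map_apply _ (by fun_prop)]
  exact (partialTraj_compProd_eq_map_traj (X := fun _ => E) zero_le).symm

theorem trajMeasure_inter_preimage_succ (μ₀ : Measure E) [IsFiniteMeasure μ₀] (n : ℕ)
    {S : Set (Π _ : Iic n, E)} (hS : MeasurableSet S) {A : Set E} (hA : MeasurableSet A) :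
    trajMeasure (X := fun _ => E) μ₀ κ {x | frestrictLe n x ∈ S ∧ x (n + 1) ∈ A} =
      ∫⁻ x in frestrictLe n ⁻¹' S, κ n (frestrictLe n x) A
        ∂(trajMeasure (X := fun _ => E) μ₀ κ) := by
  have := isFiniteMeasure_trajMeasure (κ := κ) μ₀
  have hr : Measurable (frestrictLe (π := fun _ => E) n) := by fun_prop
  have h := congrArg (fun ρ => ρ (S ×ˢ A)) (trajMeasure_map_prod (κ := κ) μ₀ n)
  simp only at h
  rw [Measure.map_apply (hr.prodMk (measurable_pi_apply (n + 1))) (hS.prod hA),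
    Measure.compProd_apply_prod hS hA, setLIntegral_map hS ((κ n).measurable_coe hA) hr] at h
  exact h

theorem trajMeasure_map_zero (μ₀ : Measure E) [IsFiniteMeasure μ₀] :
    (trajMeasure (X := fun _ => E) μ₀ κ).map (fun x => x 0) = μ₀ := by
  have he : (fun x : ℕ → E => x 0) =
      MeasurableEquiv.piUnique (fun _ : Iic 0 => E) ∘ frestrictLe 0 := rfl
  rw [he, ← Measure.map_map (MeasurableEquiv.measurable _) (by fun_prop), trajMeasure_eq_bind,
    Measure.map_comp _ _ (by fun_prop), traj_map_frestrictLe, partialTraj_self,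
    Measure.id_comp, Measure.map_map (MeasurableEquiv.measurable _) (MeasurableEquiv.measurable _),
    MeasurableEquiv.self_comp_symm, Measure.map_id]

end ProbabilityTheory.Kernel

namespace HuntProcess

/-! ### The survivor chain and non-explosion. -/

section Extinction

open Finset Preorder

variable {D Ω : Type*} [TopologicalSpace D] [MeasurableSpace Ω] {H : HuntProcess D Ω}

theorem measurable_firstDeath [T1Space (OnePoint D)] (H : HuntProcess D Ω) : Measurable H.firstDeath :=
  (H.measurable_lifetime.comp measurable_fst).min (H.measurable_lifetime.comp measurable_snd)

theorem explosionTime_eq_tsum (w : ℕ → Ω × Ω) :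
    H.explosionTime w = ∑' i, H.firstDeath (w i) := by
  rw [ENNReal.tsum_eq_iSup_nat]; rfl

theorem Extinct.firstDeath_lt_top {w : ℕ → Ω × Ω} (h : H.Extinct w) (n : ℕ) :
    H.firstDeath (w n) < ⊤ := by
  rw [Extinct, explosionTime_eq_tsum] at h
  exact (ENNReal.le_tsum n).trans_lt h

theorem Extinct.tendsto_firstDeath {w : ℕ → Ω × Ω} (h : H.Extinct w) :
    Tendsto (fun n => H.firstDeath (w n)) atTop (𝓝 0) := by
  rw [Extinct, explosionTime_eq_tsum] at h
  exact ENNReal.tendsto_atTop_zero_of_tsum_ne_top h.ne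

theorem measurableSet_extinct [T1Space (OnePoint D)] (H : HuntProcess D Ω) : MeasurableSet {w | H.Extinct w} := by
  have hm : Measurable H.explosionTime := Measurable.iSup fun n =>
    Finset.measurable_sum _ fun i _ => H.measurable_firstDeath.comp (measurable_pi_apply i)
  exact measurableSet_lt hm measurable_const

/-- Both lifetimes are almost everywhere positive and the measure is finite, so continuity from
above applies. -/
theorem tendsto_diagLaw_firstDeath_lt [LocallyCompactSpace D] [T2Space D]
    [MeasurableSpace D] [BorelSpace D] (H : HuntProcess D Ω) (m : Measure D)
    [IsFiniteMeasure m] :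
    Tendsto (fun k : ℕ => H.diagLaw m {p | H.firstDeath p < ((k : ℝ≥0∞) + 1)⁻¹}) atTop (𝓝 0) := by
  have hanti : Antitone fun k : ℕ => {p | H.firstDeath p < ((k : ℝ≥0∞) + 1)⁻¹} :=
    fun k l hkl p (hp : H.firstDeath p < _) =>
      hp.trans_le (ENNReal.inv_le_inv.2 (by gcongr))
  have h := tendsto_measure_iInter_atTop (μ := H.diagLaw m)
    (s := fun k : ℕ => {p | H.firstDeath p < ((k : ℝ≥0∞) + 1)⁻¹}) (fun k => (measurableSet_lt H.measurable_firstDeath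
      (measurable_const (a := ((k : ℝ≥0∞) + 1)⁻¹))).nullMeasurableSet) hanti
    ⟨0, measure_ne_top _ _⟩
  have h0 : H.diagLaw m (⋂ k : ℕ, {p | H.firstDeath p < ((k : ℝ≥0∞) + 1)⁻¹}) = 0 := by
    refine measure_mono_null (fun p hp => ?_) (ae_iff.1 (H.ae_diagLaw_lifetime_pos m))
    rintro ⟨h1, h2⟩
    obtain ⟨k, hk⟩ := ENNReal.exists_inv_nat_lt (lt_min h1 h2).ne'
    refine absurd (Set.mem_iInter.1 hp k) (not_lt.2 (le_trans ?_ hk.le))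
    exact ENNReal.inv_le_inv.2 le_self_add
  rwa [h0] at h

/-- The event that the first `n` branchings leave a survivor. -/
def branches (H : HuntProcess D Ω) (n : ℕ) : Set (ℕ → Ω × Ω) :=
  {w | ∀ i < n, H.survivor (w i) ≠ OnePoint.infty}

variable [LocallyCompactSpace D] [T2Space D] [SecondCountableTopology D]

theorem measurableSet_branches (H : HuntProcess D Ω) (n : ℕ) :
    MeasurableSet (H.branches n) := by
  have : H.branches n = ⋂ i, ⋂ (_ : i < n), {w | H.survivor (w i) ≠ OnePoint.infty} := by
    ext w; simp [branches]
  rw [this]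
  exact MeasurableSet.iInter fun i => MeasurableSet.iInter fun _ =>
    (H.measurable_survivor.comp (measurable_pi_apply i) (measurableSet_singleton _)).compl

/-- The law of the pair of paths after the `n`-th branching, on the event that the first `n`
branchings leave a survivor. -/
noncomputable def branchLaw (H : HuntProcess D Ω) (ρ : Measure (Ω × Ω)) (n : ℕ) :
    Measure (Ω × Ω) :=
  ((Kernel.trajMeasure (X := fun _ => Ω × Ω) ρ H.branchKernel).restrict (H.branches n)).map
    fun w => w n

theorem branchLaw_apply (ρ : Measure (Ω × Ω)) (n : ℕ) {A : Set (Ω × Ω)} (hA : MeasurableSet A) :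
    H.branchLaw ρ n A = Kernel.trajMeasure (X := fun _ => Ω × Ω) ρ H.branchKernel
      {w | w ∈ H.branches n ∧ w n ∈ A} := by
  rw [branchLaw, Measure.map_apply (measurable_pi_apply n) hA,
    Measure.restrict_apply (measurable_pi_apply n hA), Set.inter_comm]
  rfl

theorem branchLaw_zero (ρ : Measure (Ω × Ω)) [IsFiniteMeasure ρ] : H.branchLaw ρ 0 = ρ := by
  have : H.branches 0 = Set.univ := by simp [branches]
  rw [branchLaw, this, Measure.restrict_univ]
  exact Kernel.trajMeasure_map_zero ρ

theorem branchLaw_succ_apply (ρ : Measure (Ω × Ω)) [IsFiniteMeasure ρ] (n : ℕ)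
    {A : Set (Ω × Ω)} (hA : MeasurableSet A) :
    H.branchLaw ρ (n + 1) A = ∫⁻ p in {p | H.survivor p ≠ OnePoint.infty},
      (H.P (H.survivor p)).prod (H.P (H.survivor p)) A ∂(H.branchLaw ρ n) := by
  let S : Set (Π _ : Finset.Iic n, Ω × Ω) :=
    {u | ∀ i, H.survivor (u i) ≠ OnePoint.infty}
  have hS : MeasurableSet S := by
    have : S = ⋂ i, {u | H.survivor (u i) ≠ OnePoint.infty} := by
      ext u; simp [S]
    rw [this]
    exact MeasurableSet.iInter fun i =>
      (H.measurable_survivor.comp (measurable_pi_apply i) (measurableSet_singleton _)).compl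
  have hSb : frestrictLe (π := fun _ => Ω × Ω) n ⁻¹' S = H.branches (n + 1) := by
    ext w
    simp [S, branches]
  have hK : Measurable fun p => (H.P (H.survivor p)).prod (H.P (H.survivor p)) A := by
    have := (Kernel.measurable_coe (Kernel.parallelComp H.P H.P) hA).comp
      (H.measurable_survivor.prodMk H.measurable_survivor)
    simpa only [Function.comp_def, Kernel.parallelComp_apply] using this
  have hZ : MeasurableSet {p | H.survivor p ≠ OnePoint.infty} :=
    (H.measurable_survivor (measurableSet_singleton _)).compl
  have hb : H.branches (n + 1) =
      (fun w => w n) ⁻¹' {p | H.survivor p ≠ OnePoint.infty} ∩ H.branches n := by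
    ext w
    simp only [branches, Set.mem_inter_iff, Set.mem_preimage, Set.mem_ofPred_eq]
    exact ⟨fun h => ⟨h n n.lt_succ_self, fun i hi => h i (hi.trans n.lt_succ_self)⟩,
      fun h i hi => (Nat.lt_succ_iff_lt_or_eq.1 hi).elim (h.2 i) fun e => e ▸ h.1⟩
  have h := Kernel.trajMeasure_inter_preimage_succ (κ := H.branchKernel) ρ n hS hA
  have hset : {x : ℕ → Ω × Ω | frestrictLe n x ∈ S ∧ x (n + 1) ∈ A} =
      {w | w ∈ H.branches (n + 1) ∧ w (n + 1) ∈ A} := by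
    rw [← hSb]; rfl
  rw [branchLaw_apply _ _ hA, ← hset, h, hSb, branchLaw,
    setLIntegral_map hZ hK (measurable_pi_apply n),
    Measure.restrict_restrict (measurable_pi_apply n hZ), ← hb]
  refine lintegral_congr fun w => ?_
  simp [branchKernel, Kernel.parallelComp_apply]

variable [MeasurableSpace D] [BorelSpace D]

/-- The next pair consists of two copies started at the survivor, so domination of the survivor's
law by `C * m` passes to the pair. -/
theorem branchLaw_succ_le {ρ : Measure (Ω × Ω)} [IsFiniteMeasure ρ] {m : Measure D} {C : ℝ≥0∞}
    {n : ℕ} (h : ∀ B : Set D, MeasurableSet B →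
      H.branchLaw ρ n {p | H.survivor p ∈ ((↑) : D → OnePoint D) '' B} ≤ C * m B) :
    H.branchLaw ρ (n + 1) ≤ C • H.diagLaw m := by
  refine Measure.le_iff.2 fun A hA => ?_
  have hK : Measurable fun z : OnePoint D => (H.P z).prod (H.P z) A := by
    have := (Kernel.measurable_coe (Kernel.parallelComp H.P H.P) hA).comp
      (measurable_id.prodMk measurable_id)
    simpa only [Function.comp_def, Kernel.parallelComp_apply, id] using this
  have hR : MeasurableSet (Set.range ((↑) : D → OnePoint D)) :=
    OnePoint.measurableEmbedding_coe.measurableSet_range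
  have hle : ((H.branchLaw ρ n).map H.survivor).restrict
      (Set.range ((↑) : D → OnePoint D)) ≤
      C • m.map ((↑) : D → OnePoint D) := Measure.le_iff.2 fun B hB => by
    have hc := OnePoint.measurableEmbedding_coe (D := D)
    rw [Measure.restrict_apply hB, Measure.map_apply H.measurable_survivor (hB.inter hR),
      Measure.smul_apply, hc.map_apply, smul_eq_mul, ← Set.image_preimage_eq_inter_range]
    exact h _ (hc.measurable hB)
  have hset : {p | H.survivor p ≠ OnePoint.infty} =
      H.survivor ⁻¹' Set.range ((↑) : D → OnePoint D) := by
    rw [← OnePoint.compl_infty]; rfl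
  rw [branchLaw_succ_apply _ _ hA, hset, ← setLIntegral_map hR hK H.measurable_survivor]
  refine (lintegral_mono' hle le_rfl).trans ?_
  rw [lintegral_smul_measure, lintegral_map hK OnePoint.measurableEmbedding_coe.measurable,
    Measure.smul_apply, diagLaw_apply _ _ hA]

variable {m : Measure D} [IsFiniteMeasure m]

/-- Subinvariance with constant 1 keeps `C` unchanged along the induction. -/
theorem IsSelfDual.branchLaw_survivor_le (hm : H.IsSelfDual m) {ρ : Measure (Ω × Ω)}
    [IsFiniteMeasure ρ] {C : ℝ≥0∞} (h : ∀ B : Set D, MeasurableSet B →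
      ρ {p | H.survivor p ∈ ((↑) : D → OnePoint D) '' B} ≤ C * m B) (n : ℕ) (B : Set D)
    (hB : MeasurableSet B) :
    H.branchLaw ρ n {p | H.survivor p ∈ ((↑) : D → OnePoint D) '' B} ≤ C * m B := by
  induction n generalizing B with
  | zero => rw [branchLaw_zero]; exact h B hB
  | succ n ih =>
    refine (branchLaw_succ_le ih _).trans ?_
    rw [Measure.smul_apply, smul_eq_mul]
    gcongr
    exact hm.diagLaw_survivor_le hB

/-- The chain of survivors does not explode if its initial law is bounded by a multiple of `m`. -/
theorem IsSelfDual.ae_not_extinct (hm : H.IsSelfDual m) {ρ : Measure (Ω × Ω)}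
    [IsFiniteMeasure ρ] {C : ℝ≥0∞} (hC : C ≠ ⊤) (h : ∀ B : Set D, MeasurableSet B →
      ρ {p | H.survivor p ∈ ((↑) : D → OnePoint D) '' B} ≤ C * m B)
    (hρ : ∀ᵐ p ∂ρ, H.firstDeath p < ⊤ → H.survivor p ≠ OnePoint.infty) :
    ∀ᵐ w ∂(Kernel.trajMeasure (X := fun _ => Ω × Ω) ρ H.branchKernel), ¬ H.Extinct w := by
  set Q := Kernel.trajMeasure (X := fun _ => Ω × Ω) ρ H.branchKernel with hQ
  have hle : ∀ n, H.branchLaw ρ (n + 1) ≤ C • H.diagLaw m := fun n =>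
    branchLaw_succ_le (hm.branchLaw_survivor_le h n)
  have hsurv : ∀ n, ∀ᵐ p ∂(H.branchLaw ρ n),
      H.firstDeath p < ⊤ → H.survivor p ≠ OnePoint.infty := fun n => by
    cases n with
    | zero => rwa [branchLaw_zero]
    | succ n =>
      exact (Measure.absolutelyContinuous_of_le_smul (hle n)).ae_le hm.ae_diagLaw_survivor_ne
  have hstep : ∀ᵐ w ∂Q, ∀ n, w ∈ H.branches n →
      H.firstDeath (w n) < ⊤ → H.survivor (w n) ≠ OnePoint.infty :=
    ae_all_iff.2 fun n => (ae_restrict_iff' (H.measurableSet_branches n)).1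
      (ae_of_ae_map (measurable_pi_apply n).aemeasurable (hsurv n))
  -- On extinction every first death is finite, so inductively no survivor is `∂`; extinction
  -- through the cemetery is thus null.
  have hbr : ∀ᵐ w ∂Q, H.Extinct w → ∀ n, w ∈ H.branches n := by
    filter_upwards [hstep] with w hw hext n
    induction n with
    | zero => exact fun i hi => absurd hi (Nat.not_lt_zero i)
    | succ n ih =>
      exact fun i hi => (Nat.lt_succ_iff_lt_or_eq.1 hi).elim (ih i) fun e =>
        e ▸ hw n ih (hext.firstDeath_lt_top n)
  have hbound : ∀ k : ℕ, Q {w | H.Extinct w} ≤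
      C * H.diagLaw m {p | H.firstDeath p < ((k : ℝ≥0∞) + 1)⁻¹} := fun k => by
    have hset : MeasurableSet {p | H.firstDeath p < ((k : ℝ≥0∞) + 1)⁻¹} :=
      measurableSet_lt H.measurable_firstDeath measurable_const
    have h1 : Q {w | H.Extinct w} ≤ Q {w | H.Extinct w ∧ ∀ n, w ∈ H.branches n} := by
      refine measure_mono_ae ?_
      filter_upwards [hbr] with w hw hext
      exact ⟨hext, hw hext⟩
    -- The index is shifted to `n + 1` because domination by `diagLaw m` starts after the first
    -- branching.
    refine h1.trans ((measure_le_liminf_of_eventually_mem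
      (F := fun n => {w | w ∈ H.branches (n + 1) ∧
        w (n + 1) ∈ {p | H.firstDeath p < ((k : ℝ≥0∞) + 1)⁻¹}})
      (c := fun _ => C * H.diagLaw m {p | H.firstDeath p < ((k : ℝ≥0∞) + 1)⁻¹})
      (fun w hw => ?_) fun n => ?_).trans (liminf_const _).le)
    · have ht := (tendsto_add_atTop_iff_nat 1).2 hw.1.tendsto_firstDeath
      have hpos : (0 : ℝ≥0∞) < ((k : ℝ≥0∞) + 1)⁻¹ :=
        ENNReal.inv_pos.2 (by simp)
      filter_upwards [ht.eventually (gt_mem_nhds hpos)] with n hn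
      exact ⟨hw.2 _, hn⟩
    · rw [hQ, ← branchLaw_apply _ _ hset]
      exact hle n _
  have hlim := ENNReal.Tendsto.const_mul (H.tendsto_diagLaw_firstDeath_lt m) (Or.inr hC)
  rw [mul_zero] at hlim
  rw [ae_iff]
  simpa only [not_not] using le_antisymm (ge_of_tendsto' hlim hbound) zero_le

/-- The law is a mixture over initial points, which transfers almost sure statements between `μ` and
its points. -/
theorem flemingViot_apply (H : HuntProcess D Ω) (μ : Measure (D × D)) {A : Set (ℕ → Ω × Ω)}
    (hA : MeasurableSet A) :
    H.flemingViot μ A = ∫⁻ z, H.flemingViot (Measure.dirac z) A ∂μ ∧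
      Measurable fun z => H.flemingViot (Measure.dirac z) A := by
  let e := (MeasurableEquiv.piUnique fun _ : Finset.Iic 0 => Ω × Ω).symm
  let G : Ω × Ω → ℝ≥0∞ := fun p =>
    Kernel.traj (X := fun _ => Ω × Ω) H.branchKernel 0 (e p) A
  have hG : Measurable G := (Kernel.measurable_coe _ hA).comp e.measurable
  have hGP : Measurable fun z : D × D => ∫⁻ p, G p ∂((H.P z.1).prod (H.P z.2)) :=
    (Measure.measurable_lintegral hG).comp H.measurable_prod_P
  have key : ∀ ν : Measure (D × D),
      H.flemingViot ν A = ∫⁻ z, ∫⁻ p, G p ∂((H.P z.1).prod (H.P z.2)) ∂ν := fun ν => by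
    change Kernel.trajMeasure (X := fun _ => Ω × Ω) (H.pairLaw ν) H.branchKernel A = _
    rw [Kernel.trajMeasure_eq_bind, Measure.bind_apply hA (Kernel.aemeasurable _),
      lintegral_map (Kernel.measurable_coe _ hA) (MeasurableEquiv.measurable _),
      pairLaw_eq_bind, Measure.lintegral_bind H.measurable_prod_P.aemeasurable hG.aemeasurable]
  have hd : ∀ z, H.flemingViot (Measure.dirac z) A = ∫⁻ p, G p ∂((H.P z.1).prod (H.P z.2)) :=
    fun z => by rw [key, lintegral_dirac' _ hGP]
  simp only [hd]
  exact ⟨key μ, hGP⟩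

theorem ae_flemingViot_iff (H : HuntProcess D Ω) (μ : Measure (D × D)) :
    (∀ᵐ w ∂(H.flemingViot μ), ¬ H.Extinct w) ↔
      ∀ᵐ z ∂μ, ∀ᵐ w ∂(H.flemingViot (Measure.dirac z)), ¬ H.Extinct w := by
  obtain ⟨h1, h2⟩ := H.flemingViot_apply μ H.measurableSet_extinct
  simp only [ae_iff, not_not]
  rw [h1, lintegral_eq_zero_iff h2]
  rfl

end Extinction

end HuntProcess

theorem theorem1p1 {D Ω : Type*} [TopologicalSpace D] [LocallyCompactSpace D] [T2Space D]
    [SecondCountableTopology D] [MeasurableSpace D] [BorelSpace D] [MeasurableSpace Ω]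
    (H : HuntProcess D Ω) (m : Measure D) [IsFiniteMeasure m] (hm : H.IsSelfDual m) :
    (∀ᵐ z ∂(m.prod m), ∀ᵐ w ∂(H.flemingViot (Measure.dirac z)), ¬ H.Extinct w) ∧
      (∀ᵐ x ∂m, ∀ᵐ w ∂(H.flemingViot (Measure.dirac (x, x))), ¬ H.Extinct w) ∧
      (∀ μ : Measure (D × D), IsProbabilityMeasure μ → μ ≪ m.prod m →
        ∀ᵐ w ∂(H.flemingViot μ), ¬ H.Extinct w) := by
  have hprod : ∀ᵐ z ∂(m.prod m), ∀ᵐ w ∂(H.flemingViot (Measure.dirac z)), ¬ H.Extinct w :=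
    -- The factor 2 counts which particle survives; `m Set.univ` is the mass of the other starting
    -- point.
    (H.ae_flemingViot_iff _).1 (hm.ae_not_extinct (C := 2 * m Set.univ)
      (ENNReal.mul_ne_top (by simp) (measure_ne_top _ _))
      (fun _ hB => hm.pairLaw_survivor_le hB) hm.ae_pairLaw_survivor_ne)
  refine ⟨hprod, ?_, fun μ _ hμ => (H.ae_flemingViot_iff μ).2 (hμ.ae_le hprod)⟩
  -- The diagonal may be null for `m.prod m`, so the chain is rerun from `m` pushed onto it, with `C
  -- = 1`.
  refine ae_of_ae_map (f := fun x => (x, x)) (by fun_prop)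
    ((H.ae_flemingViot_iff (m.map fun x => (x, x))).1
      (hm.ae_not_extinct (ρ := H.diagLaw m) (C := 1) (by simp)
        (fun _ hB => by rw [one_mul]; exact hm.diagLaw_survivor_le hB)
        hm.ae_diagLaw_survivor_ne))
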